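/- All Hilbert spaces are complex, with inner product $\langle\cdot,\cdot\rangle$ linear in the first entry, and $\otimes$ is the Hilbert space tensor product. Let $K$ be a Pick kernel on a set $\Lambda$: a positive definite kernel such that, for every base point $\lambda_0$ with $K(\lambda_0,\lambda_0)\neq 0$, the function $1-\frac{K(\mu,\lambda_0)K(\lambda_0,\lambda)}{K(\mu,\lambda)K(\lambda_0,\lambda_0)}$ is again a positive definite kernel (it is considered on the set of points $\lambda$ with $K(\lambda,\lambda)\ne0$, where $K$ is assumed to have no zeros; if $K$ never vanishes this is all of $\Lambda$). Let $\mathfrak H(K)$ be the reproducing kernel Hilbert space of $K$, let $k_\lambda=K(\cdot,\lambda)$, fix $\lambda_0$ with $K(\lambda_0,\lambda_0)\ne 0$, and put $\delta=k_{\lambda_0}/\|k_{\lambda_0}\|$. Let $\mathcal B$ be a Hilbert space and $\beta:\Lambda\to\mathcal B$ a function with $\|\beta(\lambda)\|<1$, with $\{\beta(\lambda)\}$ total in $\mathcal B$, and with $$K(\mu,\lambda)=\frac{\delta(\mu)\overline{\delta(\lambda)}}{1-\langle\beta(\lambda),\beta(\mu)\rangle}\qquad(\lambda,\mu\in\Lambda)$$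 (such $\mathcal B,\beta$ exist). For Hilbert spaces $\mathcal G',\mathcal G$, a function $G:\Lambda\to\mathcal L(\mathcal G',\mathcal G)$ is a multiplier if $k_\lambda\otimes\xi\mapsto k_\lambda\otimes G(\lambda)^*\xi$ extends to a bounded operator $\mathfrak m_G^*:\mathfrak H(K)\otimes\mathcal G\to\mathfrak H(K)\otimes\mathcal G'$, and a contractive multiplier if it extends to a contraction; $\mathfrak m_G$ is the adjoint of this operator, and $\mathcal M_G$ is the image of $\mathfrak m_G$, with the norm $\|x\|_{\mathcal M_G}=\inf\{\|y\|:\mathfrak m_Gy=x\}$ if $G$ is contractive. The function $B(\lambda):\mathcal B\to\mathbb C$, $B(\lambda)\xi=\langle\xi,\beta(\lambda)\rangle$, is a contractive multiplier; let $\boldsymbol B=\mathfrak m_B$, regarded as an operator $\mathcal B\otimes\mathfrak H(K)\to\mathfrak H(K)$. Let $\mathcal G$ be a Hilbert space and $\mathcal M\subset\mathfrak H(K)\otimes\mathcal G$ a closed subspace such that $(\boldsymbol B\otimes I_{\mathcal G})(\mathcal B\otimes\mathcal M)\subset\mathcal M$. Then there exist a Hilbert space $\mathcal G'$ and a contractive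 multiplier $G:\Lambda\to\mathcal L(\mathcal G',\mathcal G)$ such that $\mathfrak m_G\mathfrak m_G^*$ is the orthogonal projection of $\mathfrak H(K)\otimes\mathcal G$ onto $\mathcal M$. In particular $\mathcal M=\mathcal M_G$, with equality of norms. -/

import Mathlib

universe u v

open scoped TensorProduct ComplexOrder

noncomputable section

/-! ### Hilbert space tensor products -/

/-- The Hilbert space tensor product of two complex inner product spaces: the completion of the
algebraic tensor product for `⟪x ⊗ y, x' ⊗ y'⟫ = ⟪x, x'⟫ ⟪y, y'⟫`. -/
abbrev HTensor (E F : Type*) [NormedAddCommGroup E] [InnerProductSpace ℂ E]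
    [NormedAddCommGroup F] [InnerProductSpace ℂ F] : Type _ :=
  UniformSpace.Completion (E ⊗[ℂ] F)

namespace HTensor

variable {E F E' F' G : Type*}
  [NormedAddCommGroup E] [InnerProductSpace ℂ E] [NormedAddCommGroup F] [InnerProductSpace ℂ F]
  [NormedAddCommGroup E'] [InnerProductSpace ℂ E'] [NormedAddCommGroup F'] [InnerProductSpace ℂ F']
  [NormedAddCommGroup G] [InnerProductSpace ℂ G]

/-- The simple tensor `x ⊗ y` in the Hilbert space tensor product. -/
def tmul (x : E) (y : F) : HTensor E F := ((x ⊗ₜ[ℂ] y : E ⊗[ℂ] F) : HTensor E F)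

theorem tmul_add_left (x x' : E) (y : F) : tmul (x + x') y = tmul x y + tmul x' y := by
  rw [tmul, TensorProduct.add_tmul]; exact UniformSpace.Completion.coe_add _ _

theorem tmul_smul_left (c : ℂ) (x : E) (y : F) : tmul (c • x) y = c • tmul x y := by
  rw [tmul, ← TensorProduct.smul_tmul']; exact UniformSpace.Completion.coe_smul _ _

theorem inner_tmul (x x' : E) (y y' : F) :
    inner ℂ (tmul x y) (tmul x' y') = inner ℂ x x' * inner ℂ y y' := by
  simp [tmul]

theorem denseRange_toComplL : DenseRange (UniformSpace.Completion.toComplL (𝕜 := ℂ) (E := E)) :=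
  UniformSpace.Completion.denseRange_coe

theorem isUniformInducing_toComplL :
    IsUniformInducing (UniformSpace.Completion.toComplL (𝕜 := ℂ) (E := E)) :=
  UniformSpace.Completion.isUniformInducing_coe E

/-- The tensor product `f ⊗ g` of two bounded operators. -/
def map (f : E →L[ℂ] E') (g : F →L[ℂ] F') : HTensor E F →L[ℂ] HTensor E' F' :=
  (UniformSpace.Completion.toComplL ∘L TensorProduct.mapL f g).extend
    UniformSpace.Completion.toComplL

theorem map_tmul (f : E →L[ℂ] E') (g : F →L[ℂ] F') (x : E) (y : F) :
    map f g (tmul x y) = tmul (f x) (g y) :=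
  ContinuousLinearMap.extend_eq _ denseRange_toComplL isUniformInducing_toComplL (x ⊗ₜ[ℂ] y)

/-- The simple tensors are total. -/
theorem topologicalClosure_span_tmul :
    (Submodule.span ℂ {z : HTensor E F | ∃ x y, tmul x y = z}).topologicalClosure = ⊤ := by
  rw [← Submodule.dense_iff_topologicalClosure_eq_top]
  refine (denseRange_toComplL (E := E ⊗[ℂ] F)).mono ?_
  rintro _ ⟨z, rfl⟩
  induction z using TensorProduct.induction_on with
  | zero => rw [map_zero]; exact Submodule.zero_mem _
  | tmul x y => exact Submodule.subset_span ⟨x, y, rfl⟩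
  | add a b ha hb => rw [map_add]; exact Submodule.add_mem _ ha hb

/-- Two bounded operators that agree on simple tensors are equal. -/
theorem ext_tmul {S T : HTensor E F →L[ℂ] G} (h : ∀ x y, S (tmul x y) = T (tmul x y)) :
    S = T := by
  refine ContinuousLinearMap.ext_on
    (Submodule.dense_iff_topologicalClosure_eq_top.2 topologicalClosure_span_tmul) ?_
  rintro _ ⟨x, y, rfl⟩
  exact h x y

theorem continuous_tmul_left (y : F) : Continuous fun x : E => tmul x y := by
  refine (UniformSpace.Completion.continuous_coe _).comp ?_
  refine AddMonoidHomClass.continuous_of_bound ((TensorProduct.mk ℂ E F).flip y) ‖y‖ fun x => ?_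
  simp [mul_comm]

theorem continuous_tmul_right (x : E) : Continuous fun y : F => tmul x y := by
  refine (UniformSpace.Completion.continuous_coe _).comp ?_
  refine AddMonoidHomClass.continuous_of_bound (TensorProduct.mk ℂ E F x) ‖x‖ fun y => ?_
  simp

/-- The swap `E ⊗ F ≅ F ⊗ E`. -/
def comm (E F : Type*) [NormedAddCommGroup E] [InnerProductSpace ℂ E]
    [NormedAddCommGroup F] [InnerProductSpace ℂ F] : HTensor E F ≃ₗᵢ[ℂ] HTensor F E :=
  (TensorProduct.comm ℂ E F).extendOfIsometry
    (UniformSpace.Completion.toComplL (𝕜 := ℂ) (E := E ⊗[ℂ] F)).toLinearMap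
    (UniformSpace.Completion.toComplL (𝕜 := ℂ) (E := F ⊗[ℂ] E)).toLinearMap
    denseRange_toComplL denseRange_toComplL (fun x => by simp)

theorem comm_tmul (x : E) (y : F) : comm E F (tmul x y) = tmul y x :=
  LinearEquiv.extendOfIsometry_eq (TensorProduct.comm ℂ E F) _ _ _ _ _ (x ⊗ₜ[ℂ] y)

/-- The identification `E ⊗ ℂ ≅ E` for a Hilbert space `E`. -/
def rid (E : Type*) [NormedAddCommGroup E] [InnerProductSpace ℂ E] [CompleteSpace E] :
    HTensor E ℂ ≃ₗᵢ[ℂ] E :=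
  (TensorProduct.rid ℂ E).extendOfIsometry
    (UniformSpace.Completion.toComplL (𝕜 := ℂ) (E := E ⊗[ℂ] ℂ)).toLinearMap
    LinearMap.id denseRange_toComplL denseRange_id (fun x => by simp)

theorem rid_tmul [CompleteSpace E] (x : E) (c : ℂ) : rid E (tmul x c) = c • x :=
  LinearEquiv.extendOfIsometry_eq (TensorProduct.rid ℂ E) _ _ _ _ _ (x ⊗ₜ[ℂ] c)

/-- The dense isometric inclusion of the algebraic `(E ⊗ F) ⊗ G` in `(E ⊗ F) ⊗ G`. -/
def inclLeft (E F G : Type*) [NormedAddCommGroup E] [InnerProductSpace ℂ E]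
    [NormedAddCommGroup F] [InnerProductSpace ℂ F] [NormedAddCommGroup G] [InnerProductSpace ℂ G] :
    (E ⊗[ℂ] F) ⊗[ℂ] G →ₗᵢ[ℂ] HTensor (HTensor E F) G :=
  UniformSpace.Completion.toComplₗᵢ.comp
    (TensorProduct.mapIsometry UniformSpace.Completion.toComplₗᵢ LinearIsometry.id)

/-- The dense isometric inclusion of the algebraic `E ⊗ (F ⊗ G)` in `E ⊗ (F ⊗ G)`. -/
def inclRight (E F G : Type*) [NormedAddCommGroup E] [InnerProductSpace ℂ E]
    [NormedAddCommGroup F] [InnerProductSpace ℂ F] [NormedAddCommGroup G] [InnerProductSpace ℂ G] :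
    E ⊗[ℂ] (F ⊗[ℂ] G) →ₗᵢ[ℂ] HTensor E (HTensor F G) :=
  UniformSpace.Completion.toComplₗᵢ.comp
    (TensorProduct.mapIsometry LinearIsometry.id UniformSpace.Completion.toComplₗᵢ)

theorem denseRange_inclLeft : DenseRange (inclLeft E F G) := by
  have key : ∀ (w : HTensor E F) (z : G),
      tmul w z ∈ closure (Set.range (inclLeft E F G)) := by
    intro w z
    induction w using UniformSpace.Completion.induction_on with
    | hp => exact isClosed_closure.preimage (continuous_tmul_left z)
    | ih a => exact subset_closure ⟨a ⊗ₜ[ℂ] z, by simp [inclLeft, tmul]⟩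
  have h : (LinearMap.range (inclLeft E F G).toLinearMap).topologicalClosure = ⊤ := by
    rw [eq_top_iff, ← topologicalClosure_span_tmul]
    refine Submodule.topologicalClosure_minimal _ (Submodule.span_le.2 ?_)
      (Submodule.isClosed_topologicalClosure _)
    rintro _ ⟨w, z, rfl⟩
    exact key w z
  exact Submodule.dense_iff_topologicalClosure_eq_top.2 h

theorem denseRange_inclRight : DenseRange (inclRight E F G) := by
  have key : ∀ (x : E) (w : HTensor F G),
      tmul x w ∈ closure (Set.range (inclRight E F G)) := by
    intro x w
    induction w using UniformSpace.Completion.induction_on with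
    | hp => exact isClosed_closure.preimage (continuous_tmul_right x)
    | ih a => exact subset_closure ⟨x ⊗ₜ[ℂ] a, by simp [inclRight, tmul]⟩
  have h : (LinearMap.range (inclRight E F G).toLinearMap).topologicalClosure = ⊤ := by
    rw [eq_top_iff, ← topologicalClosure_span_tmul]
    refine Submodule.topologicalClosure_minimal _ (Submodule.span_le.2 ?_)
      (Submodule.isClosed_topologicalClosure _)
    rintro _ ⟨w, z, rfl⟩
    exact key w z
  exact Submodule.dense_iff_topologicalClosure_eq_top.2 h

/-- Associativity `(E ⊗ F) ⊗ G ≅ E ⊗ (F ⊗ G)`. -/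
def assoc (E F G : Type*) [NormedAddCommGroup E] [InnerProductSpace ℂ E]
    [NormedAddCommGroup F] [InnerProductSpace ℂ F] [NormedAddCommGroup G] [InnerProductSpace ℂ G] :
    HTensor (HTensor E F) G ≃ₗᵢ[ℂ] HTensor E (HTensor F G) :=
  (TensorProduct.assoc ℂ E F G).extendOfIsometry
    (inclLeft E F G).toLinearMap (inclRight E F G).toLinearMap
    denseRange_inclLeft denseRange_inclRight (fun x => by
      simp only [LinearIsometry.coe_toLinearMap, LinearIsometry.norm_map]
      exact (TensorProduct.assocIsometry ℂ E F G).norm_map x)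

theorem assoc_tmul (x : E) (y : F) (z : G) :
    assoc E F G (tmul (tmul x y) z) = tmul x (tmul y z) := by
  have h := LinearEquiv.extendOfIsometry_eq (TensorProduct.assoc ℂ E F G)
    (inclLeft E F G).toLinearMap (inclRight E F G).toLinearMap
    denseRange_inclLeft denseRange_inclRight (fun x => by
      simp only [LinearIsometry.coe_toLinearMap, LinearIsometry.norm_map]
      exact (TensorProduct.assocIsometry ℂ E F G).norm_map x) ((x ⊗ₜ[ℂ] y) ⊗ₜ[ℂ] z)
  have hl : inclLeft E F G ((x ⊗ₜ[ℂ] y) ⊗ₜ[ℂ] z) = tmul (tmul x y) z := by simp [inclLeft, tmul]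
  have hr : inclRight E F G (x ⊗ₜ[ℂ] (y ⊗ₜ[ℂ] z)) = tmul x (tmul y z) := by simp [inclRight, tmul]
  rw [← hl, ← hr]
  exact h

/-- The closed subspace `E ⊗ M` of `E ⊗ F`, for a subspace `M` of `F`: the image of the Hilbert
space tensor product of `E` and `M` under `I ⊗ ι`, with `ι : M → F` the inclusion. -/
def tensorSubspace (E : Type*) [NormedAddCommGroup E] [InnerProductSpace ℂ E]
    (M : Submodule ℂ F) : Submodule ℂ (HTensor E F) :=
  LinearMap.range (map (ContinuousLinearMap.id ℂ E) M.subtypeL).toLinearMap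

end HTensor

/-! ### Multipliers of a reproducing kernel Hilbert space -/

section Multipliers

variable {Λ : Type*} (H : Type*) [NormedAddCommGroup H] [InnerProductSpace ℂ H] [CompleteSpace H]
  [RKHS ℂ H Λ ℂ]
  {𝒢' 𝒢 : Type*} [NormedAddCommGroup 𝒢'] [InnerProductSpace ℂ 𝒢'] [CompleteSpace 𝒢']
  [NormedAddCommGroup 𝒢] [InnerProductSpace ℂ 𝒢] [CompleteSpace 𝒢]

/-- The kernel function `k_l ∈ H`, for which `f l = ⟪k_l, f⟫`. -/
def kernelVec (l : Λ) : H := RKHS.kerFun H l (1 : ℂ)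

/-- `K` is the reproducing kernel of `H`, i.e. `k_l m = K m l`. -/
def HasKernel (K : Λ → Λ → ℂ) : Prop := ∀ m l, kernelVec H l m = K m l

/-- `S` is a bounded extension of the map `k_l ⊗ ξ ↦ k_l ⊗ (G l)* ξ`. -/
def IsMultiplierAdjoint (G : Λ → 𝒢' →L[ℂ] 𝒢) (S : HTensor H 𝒢 →L[ℂ] HTensor H 𝒢') : Prop :=
  ∀ (l : Λ) (ξ : 𝒢), S (HTensor.tmul (kernelVec H l) ξ) =
    HTensor.tmul (kernelVec H l) ((G l).adjoint ξ)

/-- `G` is a multiplier: `k_l ⊗ ξ ↦ k_l ⊗ (G l)* ξ` extends to a bounded operator. -/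
def IsMultiplier (G : Λ → 𝒢' →L[ℂ] 𝒢) : Prop := ∃ S, IsMultiplierAdjoint H G S

/-- `G` is a contractive multiplier: `k_l ⊗ ξ ↦ k_l ⊗ (G l)* ξ` extends to a contraction. -/
def IsContractiveMultiplier (G : Λ → 𝒢' →L[ℂ] 𝒢) : Prop :=
  ∃ S, IsMultiplierAdjoint H G S ∧ ‖S‖ ≤ 1

open Classical in
/-- The multiplication operator `m_G : H ⊗ 𝒢' → H ⊗ 𝒢` of a multiplier `G`, the adjoint of the
bounded extension of `k_l ⊗ ξ ↦ k_l ⊗ (G l)* ξ`. (It is `0` if `G` is not a multiplier.) -/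
def mulOp (G : Λ → 𝒢' →L[ℂ] 𝒢) : HTensor H 𝒢' →L[ℂ] HTensor H 𝒢 :=
  if h : IsMultiplier H G then h.choose.adjoint else 0

theorem topologicalClosure_span_kernelVec :
    (Submodule.span ℂ (Set.range (kernelVec (Λ := Λ) H))).topologicalClosure = ⊤ := by
  rw [← RKHS.kerFun_dense H]
  congr 1
  refine le_antisymm (Submodule.span_mono ?_) (Submodule.span_le.2 ?_)
  · rintro _ ⟨l, rfl⟩
    exact ⟨l, 1, rfl⟩
  · rintro _ ⟨l, c, rfl⟩
    have : RKHS.kerFun H l c = c • kernelVec H l := by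
      rw [kernelVec, ← map_smul, smul_eq_mul, mul_one]
    rw [this]
    exact Submodule.smul_mem _ _ (Submodule.subset_span ⟨l, rfl⟩)

variable {H}

/-- The bounded extension of `k_l ⊗ ξ ↦ k_l ⊗ (G l)* ξ` is unique. -/
theorem IsMultiplierAdjoint.unique {G : Λ → 𝒢' →L[ℂ] 𝒢} {S T : HTensor H 𝒢 →L[ℂ] HTensor H 𝒢'}
    (hS : IsMultiplierAdjoint H G S) (hT : IsMultiplierAdjoint H G T) : S = T := by
  refine HTensor.ext_tmul fun x y => ?_
  have hcl : IsClosed {x : H | S (HTensor.tmul x y) = T (HTensor.tmul x y)} :=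
    isClosed_eq (S.continuous.comp (HTensor.continuous_tmul_left y))
      (T.continuous.comp (HTensor.continuous_tmul_left y))
  have hd : Dense (Submodule.span ℂ (Set.range (kernelVec (Λ := Λ) H)) : Set H) :=
    Submodule.dense_iff_topologicalClosure_eq_top.2 (topologicalClosure_span_kernelVec H)
  refine hcl.closure_subset_iff.2 (fun x hx => ?_) (hd x)
  induction hx using Submodule.span_induction with
  | mem x hx => obtain ⟨l, rfl⟩ := hx; exact (hS l y).trans (hT l y).symm
  | zero =>
    have h0 : HTensor.tmul (0 : H) y = 0 := by
      simpa using HTensor.tmul_smul_left (0 : ℂ) (0 : H) y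
    simp [h0]
  | add a b _ _ ha hb => simp_all [HTensor.tmul_add_left]
  | smul c a _ ha => simp_all [HTensor.tmul_smul_left]

theorem mulOp_eq {G : Λ → 𝒢' →L[ℂ] 𝒢} {S : HTensor H 𝒢 →L[ℂ] HTensor H 𝒢'}
    (hS : IsMultiplierAdjoint H G S) : mulOp H G = S.adjoint := by
  have h : IsMultiplier H G := ⟨S, hS⟩
  rw [mulOp, dif_pos h, h.choose_spec.unique hS]

end Multipliers

/-- The norm of the range space of `C : E → F`: `‖x‖_C = inf {‖y‖ : C y = x}`. -/
def rangeNorm {E F : Type*} [NormedAddCommGroup E] [InnerProductSpace ℂ E]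
    [NormedAddCommGroup F] [InnerProductSpace ℂ F] (C : E →L[ℂ] F) (x : F) : ℝ :=
  sInf {r : ℝ | ∃ y : E, C y = x ∧ ‖y‖ = r}

/-! ### Pick kernels -/

section Pick

variable {Λ : Type*}

/-- A Pick kernel: a positive definite kernel `K` such that for each base point `l₀` the function
`1 - K(m, l₀) K(l₀, l) / (K(m, l) K(l₀, l₀))` is again a positive definite kernel. Points `l` with
`K l l = 0`, at which all functions of the space vanish, are left aside; at the other points the
denominator must not vanish. -/
structure IsPickKernel (K : Λ → Λ → ℂ) : Prop where
  posSemidef : Matrix.PosSemidef (Matrix.of K)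
  ne_zero : ∀ m l, K m m ≠ 0 → K l l ≠ 0 → K m l ≠ 0
  pick : ∀ l₀, K l₀ l₀ ≠ 0 → Matrix.PosSemidef
    (Matrix.of fun m l : {l : Λ // K l l ≠ 0} =>
      1 - K m l₀ * K l₀ l / (K m l * K l₀ l₀))

variable (H : Type*) [NormedAddCommGroup H] [InnerProductSpace ℂ H] [CompleteSpace H]
  [RKHS ℂ H Λ ℂ]
  {𝓑 : Type*} [NormedAddCommGroup 𝓑] [InnerProductSpace ℂ 𝓑] [CompleteSpace 𝓑]

/-- The function `δ = k_{l₀} / ‖k_{l₀}‖`. -/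
def deltaVec (l₀ : Λ) : H := ((‖kernelVec H l₀‖⁻¹ : ℝ) : ℂ) • kernelVec H l₀

/-- `β : Λ → 𝓑` represents the Pick kernel `K` with base point `l₀`:
`K(m, l) = δ(m) conj(δ(l)) / (1 - ⟨β(l), β(m)⟩)` (the product `⟨·, ·⟩` being linear in its first
entry), and `𝓑` is minimal. -/
structure IsPickRepresentation (K : Λ → Λ → ℂ) (l₀ : Λ) (β : Λ → 𝓑) : Prop where
  base_ne_zero : K l₀ l₀ ≠ 0
  norm_lt_one : ∀ l, ‖β l‖ < 1
  eq_kernel : ∀ m l, K m l =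
    deltaVec H l₀ m * star (deltaVec H l₀ l) / (1 - inner ℂ (β m) (β l))
  minimal : (Submodule.span ℂ (Set.range β)).topologicalClosure = ⊤

/-- The operators `B(l) : 𝓑 → ℂ`, `B(l) ξ = ⟨ξ, β(l)⟩` (linear in `ξ`). -/
def rowB (β : Λ → 𝓑) (l : Λ) : 𝓑 →L[ℂ] ℂ := innerSL ℂ (β l)

/-- The operator `𝐁 = m_B`, regarded as an operator `𝓑 ⊗ H → H`. -/
def boldB (β : Λ → 𝓑) : HTensor 𝓑 H →L[ℂ] H :=
  (HTensor.rid H).toContinuousLinearEquiv.toContinuousLinearMap ∘L mulOp H (rowB β) ∘L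
    (HTensor.comm 𝓑 H).toContinuousLinearEquiv.toContinuousLinearMap

/-- The operator `𝐁 ⊗ I : 𝓑 ⊗ (H ⊗ 𝒢) ≅ (𝓑 ⊗ H) ⊗ 𝒢 → H ⊗ 𝒢`. -/
def boldBTensorId (𝒢 : Type*) [NormedAddCommGroup 𝒢] [InnerProductSpace ℂ 𝒢] (β : Λ → 𝓑) :
    HTensor 𝓑 (HTensor H 𝒢) →L[ℂ] HTensor H 𝒢 :=
  HTensor.map (boldB H β) (ContinuousLinearMap.id ℂ 𝒢) ∘L
    (HTensor.assoc 𝓑 H 𝒢).symm.toContinuousLinearEquiv.toContinuousLinearMap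

end Pick

/-! ### A Pick kernel has a representation -/

section Representation
variable {Λ : Type*} (H : Type*) [NormedAddCommGroup H] [InnerProductSpace ℂ H] [CompleteSpace H]
  [RKHS ℂ H Λ ℂ] {K : Λ → Λ → ℂ}

theorem HasKernel.inner_kernelVec {H : Type*} [NormedAddCommGroup H] [InnerProductSpace ℂ H]
    [CompleteSpace H] [RKHS ℂ H Λ ℂ] (hH : HasKernel H K) (m l : Λ) :
    inner ℂ (kernelVec H m) (kernelVec H l) = K m l := by
  rw [← hH m l, kernelVec, RKHS.kerFun_inner]
  simp [kernelVec]

/-- Every positive semidefinite kernel is a Gram kernel of a total family. -/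
theorem exists_gram {N : Type u} {F : N → N → ℂ} (hF : Matrix.PosSemidef (Matrix.of F)) :
    ∃ (𝓑 : Type u) (_ : NormedAddCommGroup 𝓑) (_ : InnerProductSpace ℂ 𝓑) (_ : CompleteSpace 𝓑)
      (b : N → 𝓑), (∀ m l, inner ℂ (b m) (b l) = F m l) ∧
        (Submodule.span ℂ (Set.range b)).topologicalClosure = ⊤ := by
  let K' : Matrix N N (ℂ →L[ℂ] ℂ) := Matrix.of fun m l => F m l • ContinuousLinearMap.id ℂ ℂ
  have hK' : K'.PosSemidef := by
    have hher : K'.IsHermitian := by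
      ext m l
      have := hF.isHermitian.apply m l
      simp only [Matrix.of_apply] at this
      simp [K', Matrix.conjTranspose_apply, star_smul, ContinuousLinearMap.star_eq_adjoint,
        ContinuousLinearMap.adjoint_id, ← this]
    have hpos : ∀ v : N →₀ ℂ, 0 ≤ RCLike.re (v.sum fun x w => v.sum fun x' w' =>
        inner ℂ (K' x' x w) w') := by
      intro v
      have h := (Complex.nonneg_iff.1 (hF.2 v)).1
      refine h.trans_eq ?_
      have hc : ∀ a b, (starRingEnd ℂ) (F a b) = F b a := fun a b => hF.isHermitian.apply b a
      simp [K', hc, mul_comm]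
    exact ((RKHS.posSemidef_tfae (K := K')).out 0 2).2 (And.intro hher hpos)
  have : Fact K'.PosSemidef := ⟨hK'⟩
  refine ⟨RKHS.OfKernel K', inferInstance, inferInstance, inferInstance,
    fun l => kernelVec (RKHS.OfKernel K') l, fun m l => ?_, ?_⟩
  · refine (RKHS.kernel_inner (RKHS.OfKernel K') l m (1 : ℂ) (1 : ℂ)).symm.trans ?_
    simpa [K'] using hF.isHermitian.apply m l
  · exact topologicalClosure_span_kernelVec _

/-- A Pick kernel has, for every base point, a representation through some `β`. -/
theorem IsPickKernel.exists_representation {Λ : Type u} {K : Λ → Λ → ℂ} (hK : IsPickKernel K)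
    (H : Type*) [NormedAddCommGroup H] [InnerProductSpace ℂ H] [CompleteSpace H] [RKHS ℂ H Λ ℂ]
    (hH : HasKernel H K) (l₀ : Λ) (h₀ : K l₀ l₀ ≠ 0) :
    ∃ (𝓑 : Type u) (_ : NormedAddCommGroup 𝓑) (_ : InnerProductSpace ℂ 𝓑) (_ : CompleteSpace 𝓑)
      (β : Λ → 𝓑), IsPickRepresentation H K l₀ β := by
  classical
  obtain ⟨𝓑, i1, i2, i3, b, hb, hd⟩ := exists_gram (hK.pick l₀ h₀)
  have hin := hH.inner_kernelVec
  have hz : ∀ l, K l l = 0 → kernelVec H l = 0 := fun l hl =>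
    inner_self_eq_zero.1 ((hin l l).trans hl)
  have hconj : ∀ m l, star (K m l) = K l m := fun m l => by
    rw [← hin m l, ← hin l m]; exact inner_conj_symm _ _
  have hdel : ∀ m l, deltaVec H l₀ m * star (deltaVec H l₀ l) = K m l₀ * K l₀ l / K l₀ l₀ := by
    intro m l
    have h2 : K l₀ l₀ = (‖kernelVec H l₀‖ : ℂ) ^ 2 := by
      rw [← hin l₀ l₀]; exact inner_self_eq_norm_sq_to_K _
    have h3 : (‖kernelVec H l₀‖ : ℂ) ≠ 0 := fun h => h₀ (by rw [h2, h]; simp)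
    simp only [deltaVec, RKHS.coe_smul, Pi.smul_apply, hH m l₀, hH l l₀, smul_eq_mul, star_mul',
      hconj l l₀]
    rw [h2]
    simp
    field_simp
  refine ⟨𝓑, i1, i2, i3, fun l => if h : K l l ≠ 0 then b ⟨l, h⟩ else 0, ⟨h₀, fun l => ?_,
    fun m l => ?_, ?_⟩⟩
  · by_cases h : K l l = 0
    · simp [h]
    · simp only [ne_eq, h, not_false_eq_true, dite_true]
      have h1 := hb ⟨l, h⟩ ⟨l, h⟩
      have hne := hK.ne_zero l l₀ h h₀
      have e1 : K l l = ((‖kernelVec H l‖ ^ 2 : ℝ) : ℂ) := by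
        rw [← hin l l]; push_cast; exact inner_self_eq_norm_sq_to_K _
      have e2 : K l₀ l₀ = ((‖kernelVec H l₀‖ ^ 2 : ℝ) : ℂ) := by
        rw [← hin l₀ l₀]; push_cast; exact inner_self_eq_norm_sq_to_K _
      have e3 : K l l₀ * K l₀ l = ((‖K l l₀‖ ^ 2 : ℝ) : ℂ) := by
        rw [← hconj l l₀]; push_cast; exact Complex.mul_conj' _
      rw [inner_self_eq_norm_sq_to_K, e3, e1, e2] at h1
      have h1' : ‖b ⟨l, h⟩‖ ^ 2 =
          1 - ‖K l l₀‖ ^ 2 / (‖kernelVec H l‖ ^ 2 * ‖kernelVec H l₀‖ ^ 2) := by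
        refine Complex.ofReal_injective ?_
        push_cast
        push_cast at h1
        exact h1
      have p1 : 0 < ‖kernelVec H l‖ := norm_pos_iff.2 fun h' => h (by rw [e1, h']; simp)
      have p2 : 0 < ‖kernelVec H l₀‖ := norm_pos_iff.2 fun h' => h₀ (by rw [e2, h']; simp)
      have p3 : 0 < ‖K l l₀‖ := norm_pos_iff.2 hne
      have p4 : 0 < ‖K l l₀‖ ^ 2 / (‖kernelVec H l‖ ^ 2 * ‖kernelVec H l₀‖ ^ 2) := by positivity
      nlinarith [norm_nonneg (b ⟨l, h⟩)]
  · rw [hdel]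
    by_cases hm : K m m = 0
    · rw [← hin m l, ← hin m l₀, hz m hm]; simp
    by_cases hl : K l l = 0
    · rw [← hin m l, ← hin l₀ l, hz l hl]; simp
    simp only [ne_eq, hm, hl, not_false_eq_true, dite_true]
    rw [hb ⟨m, hm⟩ ⟨l, hl⟩]
    have := hK.ne_zero m l hm hl
    have := hK.ne_zero m l₀ hm h₀
    have := hK.ne_zero l₀ l h₀ hl
    rw [sub_sub_cancel]
    field_simp
  · rw [eq_top_iff, ← hd]
    refine Submodule.topologicalClosure_mono (Submodule.span_mono ?_)
    rintro _ ⟨⟨l, h⟩, rfl⟩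
    exact ⟨l, by simp [h]⟩

end Representation

end

/-!
Write `P` for the projection onto `M` and `D = 𝐁 ⊗ I`. The kernel identity says that
`k_l ↦ (β(l) ⊗ k_l, conj δ(l))` is isometric, so `D` is a contraction with
`D†(k_l ⊗ ξ) = β(l) ⊗ (k_l ⊗ ξ)`. Invariance of `M` means that `C = D (I ⊗ P)` has range in `M`, so
`P - C C† = R† R` for some operator `R` on `H ⊗ 𝒢`, and on kernel functions
`⟪R (k_m ⊗ η), R (k_l ⊗ ξ)⟫ = (1 - ⟪β(m), β(l)⟫) ⟪k_m ⊗ η, P (k_l ⊗ ξ)⟫`. Dividing by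
`1 - ⟪β(m), β(l)⟫ = δ(m) conj δ(l) / K(m, l)` shows that
`G(l)† ξ = R (k_l ⊗ ξ) / conj δ(l)` satisfies
`⟪k_m ⊗ G(m)† η, k_l ⊗ G(l)† ξ⟫ = ⟪k_m ⊗ η, P (k_l ⊗ ξ)⟫`, which is `m_G m_G† = P`.
-/

open scoped InnerProductSpace InnerProduct

section Hilbert

variable {𝕜 E F X : Type*} [RCLike 𝕜]
  [NormedAddCommGroup E] [InnerProductSpace 𝕜 E] [NormedAddCommGroup F] [InnerProductSpace 𝕜 F]
  [NormedAddCommGroup X] [InnerProductSpace 𝕜 X]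

theorem one_sub_inner_ne_zero {x y : E} (hx : ‖x‖ < 1) (hy : ‖y‖ < 1) : 1 - ⟪x, y⟫_𝕜 ≠ 0 := by
  intro h
  have h_one : ‖⟪x, y⟫_𝕜‖ = 1 := by rw [← sub_eq_zero.1 h, norm_one]
  have h_lt : ‖x‖ * ‖y‖ < 1 := mul_lt_one_of_nonneg_of_lt_one_left (norm_nonneg x) hx hy.le
  exact (h_one.symm.trans_le (norm_inner_le_norm x y)).not_gt h_lt

theorem norm_self_comp_adjoint [CompleteSpace E] [CompleteSpace F] (C : E →L[𝕜] F) :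
    ‖C ∘L C†‖ = ‖C‖ * ‖C‖ := by
  simpa using (C†).norm_adjoint_comp_self

theorem exists_clm_of_inner_eq [CompleteSpace F] {ι : Type*} {v : ι → E}
    (hv : (Submodule.span 𝕜 (Set.range v)).topologicalClosure = ⊤) (w : ι → F) (J : E →L[𝕜] X)
    (h : ∀ i j, ⟪w i, w j⟫_𝕜 = ⟪J (v i), J (v j)⟫_𝕜) :
    ∃ S : E →L[𝕜] F, (∀ i, S (v i) = w i) ∧ ∀ x y, ⟪S x, S y⟫_𝕜 = ⟪J x, J y⟫_𝕜 := by
  set e := Finsupp.linearCombination 𝕜 v with he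
  set f := Finsupp.linearCombination 𝕜 w with hf
  have he_dense : DenseRange e := by
    rw [← Submodule.dense_iff_topologicalClosure_eq_top, ← Finsupp.range_linearCombination] at hv
    exact hv
  have h_inner : ∀ a b, ⟪f a, f b⟫_𝕜 = ⟪J (e a), J (e b)⟫_𝕜 := fun a b => by
    simp only [he, hf, Finsupp.linearCombination_apply, Finsupp.sum, map_sum, map_smul, sum_inner,
      inner_sum, inner_smul_left, inner_smul_right, h]
  have h_bound : ∀ a, ‖f a‖ ≤ ‖J‖ * ‖e a‖ := fun a => by
    rw [@norm_eq_sqrt_re_inner 𝕜, h_inner, ← norm_eq_sqrt_re_inner]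
    exact J.le_opNorm _
  have h_ext : ∀ a, f.extendOfNorm e (e a) = f a := LinearMap.extendOfNorm_eq he_dense ⟨_, h_bound⟩
  refine ⟨f.extendOfNorm e, fun i => ?_, fun x y => ?_⟩
  · simpa [he, hf] using h_ext (Finsupp.single i 1)
  · induction x, y using he_dense.induction_on₂ with
    | hp => exact isClosed_eq (by fun_prop) (by fun_prop)
    | h a b => rw [h_ext, h_ext, h_inner]

theorem exists_contraction_of_inner_add_inner_eq [CompleteSpace F] [CompleteSpace X] {ι : Type*}
    {v : ι → E} (hv : (Submodule.span 𝕜 (Set.range v)).topologicalClosure = ⊤)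
    (w : ι → F) (u : ι → X) (h : ∀ i j, ⟪w i, w j⟫_𝕜 + ⟪u i, u j⟫_𝕜 = ⟪v i, v j⟫_𝕜) :
    ∃ T : E →L[𝕜] F, (∀ i, T (v i) = w i) ∧ ‖T‖ ≤ 1 := by
  obtain ⟨V, hV, hV_inner⟩ := exists_clm_of_inner_eq hv (fun i => WithLp.toLp 2 (w i, u i))
    (ContinuousLinearMap.id 𝕜 E) fun i j => by simpa using h i j
  refine ⟨WithLp.fstL 2 𝕜 F X ∘L V, fun i => by simp [hV], ?_⟩
  refine ContinuousLinearMap.opNorm_le_bound _ zero_le_one fun x => ?_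
  calc ‖(V x).fst‖ ≤ ‖V x‖ := WithLp.norm_fst_le _ _
    _ = 1 * ‖x‖ := by
      rw [one_mul, @norm_eq_sqrt_re_inner 𝕜, hV_inner, @norm_eq_sqrt_re_inner 𝕜 _ _ _ _ x]; rfl

end Hilbert

section Projection

variable {𝕜 E X : Type*} [RCLike 𝕜]
  [NormedAddCommGroup E] [InnerProductSpace 𝕜 E] [CompleteSpace E]
  [NormedAddCommGroup X] [InnerProductSpace 𝕜 X] [CompleteSpace X]
  {C : E →L[𝕜] X} {M : Submodule 𝕜 X} [M.HasOrthogonalProjection]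

theorem norm_le_one_of_self_comp_adjoint_eq_starProjection
    (hC : C ∘L C† = M.starProjection) : ‖C‖ ≤ 1 := by
  have h_sq : ‖C‖ * ‖C‖ ≤ 1 := by
    rw [← norm_self_comp_adjoint, hC]
    exact M.starProjection_norm_le
  nlinarith

theorem range_eq_of_self_comp_adjoint_eq_starProjection
    (hC : C ∘L C† = M.starProjection) : C.range = M := by
  have h_orthogonal : C.rangeᗮ = Mᗮ := by
    rw [C.orthogonal_range, ← (C†).ker_adjoint_comp_self, C.adjoint_adjoint, hC,
      M.ker_starProjection]
  refine le_antisymm ?_ fun x hx =>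
    ⟨(C†) x, (DFunLike.congr_fun hC x).trans (Submodule.starProjection_eq_self_iff.2 hx)⟩
  calc C.range ≤ C.rangeᗮᗮ := Submodule.le_orthogonal_orthogonal _
    _ = M := by rw [h_orthogonal, M.orthogonal_orthogonal]

theorem rangeNorm_eq_norm_of_self_comp_adjoint_eq_starProjection {E X : Type*}
    [NormedAddCommGroup E] [InnerProductSpace ℂ E] [CompleteSpace E]
    [NormedAddCommGroup X] [InnerProductSpace ℂ X] [CompleteSpace X]
    {C : E →L[ℂ] X} {M : Submodule ℂ X} [M.HasOrthogonalProjection]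
    (hC : C ∘L C† = M.starProjection) {x : X} (hx : x ∈ M) : rangeNorm C x = ‖x‖ := by
  have hC_norm : ‖C‖ ≤ 1 := norm_le_one_of_self_comp_adjoint_eq_starProjection hC
  have hC_le : ∀ y, ‖C y‖ ≤ ‖y‖ := fun y => by simpa using C.le_of_opNorm_le hC_norm y
  have hCx : C ((C†) x) = x :=
    (DFunLike.congr_fun hC x).trans (Submodule.starProjection_eq_self_iff.2 hx)
  have hx_norm : ‖(C†) x‖ = ‖x‖ := by
    refine le_antisymm ?_ ?_
    · simpa using (C†).le_of_opNorm_le ((LinearIsometryEquiv.norm_map _ C).trans_le hC_norm) x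
    · simpa only [hCx] using hC_le ((C†) x)
  refine IsLeast.csInf_eq ⟨⟨(C†) x, hCx, hx_norm⟩, ?_⟩
  rintro _ ⟨y, rfl, rfl⟩
  exact hC_le y

end Projection

section Defect

variable {E X : Type*} [NormedAddCommGroup E] [InnerProductSpace ℂ E] [CompleteSpace E]
  [NormedAddCommGroup X] [InnerProductSpace ℂ X] [CompleteSpace X]

theorem exists_inner_eq_inner_sub_inner_adjoint (C : E →L[ℂ] X) (hC : ‖C‖ ≤ 1) :
    ∃ S : X →L[ℂ] X, ∀ x y, ⟪S x, S y⟫_ℂ = ⟪x, y⟫_ℂ - ⟪(C†) x, (C†) y⟫_ℂ := by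
  have h_nonneg : 0 ≤ C ∘L C† := by
    rw [ContinuousLinearMap.nonneg_iff_isPositive]
    exact C.isPositive_self_comp_adjoint
  have h_norm : ‖C ∘L C†‖ ≤ 1 :=
    (norm_self_comp_adjoint C).trans_le (mul_le_one₀ hC (norm_nonneg _) hC)
  have h_defect : 0 ≤ 1 - C ∘L C† :=
    sub_nonneg.2 ((CStarAlgebra.norm_le_one_iff_of_nonneg _ h_nonneg).1 h_norm)
  set S := CFC.sqrt (1 - C ∘L C†)
  have hS : S† = S := (IsSelfAdjoint.of_nonneg (CFC.sqrt_nonneg _)).adjoint_eq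
  have hSS : S * S = 1 - C ∘L C† := CFC.sqrt_mul_sqrt_self _ h_defect
  refine ⟨S, fun x y => ?_⟩
  calc ⟪S x, S y⟫_ℂ = ⟪x, (S * S) y⟫_ℂ := by
        rw [← S.adjoint_inner_right, hS]; rfl
    _ = ⟪x, y⟫_ℂ - ⟪(C†) x, (C†) y⟫_ℂ := by
        rw [hSS, C.adjoint_inner_left, ← inner_sub_right]; rfl

theorem exists_inner_eq_inner_starProjection_sub_inner_adjoint (C : E →L[ℂ] X) (hC : ‖C‖ ≤ 1)
    (M : Submodule ℂ X) [M.HasOrthogonalProjection] (hM : ∀ z, C z ∈ M) :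
    ∃ R : X →L[ℂ] X, ∀ x y,
      ⟪R x, R y⟫_ℂ = ⟪M.starProjection x, M.starProjection y⟫_ℂ - ⟪(C†) x, (C†) y⟫_ℂ := by
  have hPC : M.starProjection ∘L C = C :=
    ContinuousLinearMap.ext fun z => Submodule.starProjection_eq_self_iff.2 (hM z)
  have hCP : ∀ x, (C†) (M.starProjection x) = (C†) x := fun x => by
    conv_rhs => rw [← hPC, ContinuousLinearMap.adjoint_comp,
      (isSelfAdjoint_starProjection M).adjoint_eq]
    rfl
  obtain ⟨S, hS⟩ := exists_inner_eq_inner_sub_inner_adjoint C hC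
  exact ⟨S ∘L M.starProjection, fun x y => by
    simpa only [ContinuousLinearMap.comp_apply, hCP] using
      hS (M.starProjection x) (M.starProjection y)⟩

end Defect

namespace HTensor

variable {E F E' F' : Type*}
  [NormedAddCommGroup E] [InnerProductSpace ℂ E] [NormedAddCommGroup F] [InnerProductSpace ℂ F]
  [NormedAddCommGroup E'] [InnerProductSpace ℂ E'] [NormedAddCommGroup F'] [InnerProductSpace ℂ F']

theorem tmul_add_right (x : E) (y y' : F) : tmul x (y + y') = tmul x y + tmul x y' := by
  rw [tmul, TensorProduct.tmul_add]; exact UniformSpace.Completion.coe_add _ _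

theorem tmul_smul_right (c : ℂ) (x : E) (y : F) : tmul x (c • y) = c • tmul x y := by
  rw [tmul, TensorProduct.tmul_smul]; exact UniformSpace.Completion.coe_smul _ _

theorem zero_tmul (y : F) : tmul (0 : E) y = 0 := by
  simpa using tmul_smul_left (0 : ℂ) (0 : E) y

/-- The bounded operator `y ↦ x ⊗ y`. -/
noncomputable def tmulL (F : Type*) [NormedAddCommGroup F] [InnerProductSpace ℂ F] (x : E) :
    F →L[ℂ] HTensor E F where
  toFun := tmul x
  map_add' := tmul_add_right x
  map_smul' c y := tmul_smul_right c x y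
  cont := continuous_tmul_right x

@[simp]
theorem tmulL_apply (x : E) (y : F) : tmulL F x y = tmul x y := rfl

theorem norm_map_le (f : E →L[ℂ] E') (g : F →L[ℂ] F') : ‖map f g‖ ≤ ‖f‖ * ‖g‖ := by
  refine ContinuousLinearMap.opNorm_le_bound _ (by positivity) fun z => ?_
  induction z using UniformSpace.Completion.induction_on with
  | hp => exact isClosed_le (by fun_prop) (by fun_prop)
  | ih a =>
    have h_coe : map f g a = ((TensorProduct.mapL f g a : E' ⊗[ℂ] F') : HTensor E' F') :=
      ContinuousLinearMap.extend_eq _ denseRange_toComplL isUniformInducing_toComplL a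
    rw [h_coe, UniformSpace.Completion.norm_coe, UniformSpace.Completion.norm_coe]
    exact (TensorProduct.mapL f g).le_of_opNorm_le (TensorProduct.norm_mapL_le f g) a

theorem ext_inner_tmul {a b : HTensor E F} (h : ∀ x y, ⟪a, tmul x y⟫_ℂ = ⟪b, tmul x y⟫_ℂ) :
    a = b := by
  have h_inner : innerSL ℂ a = innerSL ℂ b := ext_tmul h
  exact ext_inner_right ℂ fun z => DFunLike.congr_fun h_inner z

theorem adjoint_map [CompleteSpace E] [CompleteSpace F] [CompleteSpace E'] [CompleteSpace F']
    (f : E →L[ℂ] E') (g : F →L[ℂ] F') : (map f g)† = map (f†) (g†) := by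
  refine ext_tmul fun x y => ext_inner_tmul fun x' y' => ?_
  simp only [ContinuousLinearMap.adjoint_inner_left, map_tmul, inner_tmul]

theorem topologicalClosure_span_tmul_of_total {ι : Type*} {v : ι → E}
    (hv : (Submodule.span ℂ (Set.range v)).topologicalClosure = ⊤) :
    (Submodule.span ℂ (Set.range fun p : ι × F => tmul (v p.1) p.2)).topologicalClosure = ⊤ := by
  set N := (Submodule.span ℂ (Set.range fun p : ι × F => tmul (v p.1) p.2)).topologicalClosure
  have hN : IsClosed (N : Set (HTensor E F)) := Submodule.isClosed_topologicalClosure _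
  rw [eq_top_iff, ← topologicalClosure_span_tmul]
  refine Submodule.topologicalClosure_minimal _ (Submodule.span_le.2 ?_) hN
  rintro _ ⟨x, y, rfl⟩
  let tmulRight : E →ₗ[ℂ] HTensor E F :=
    { toFun := (tmul · y), map_add' := (tmul_add_left · · y), map_smul' := (tmul_smul_left · · y) }
  have h_span : Submodule.span ℂ (Set.range v) ≤ N.comap tmulRight := by
    rw [Submodule.span_le]
    rintro _ ⟨i, rfl⟩
    exact Submodule.le_topologicalClosure _ (Submodule.subset_span ⟨(i, y), rfl⟩)
  have h_closure := Submodule.topologicalClosure_minimal _ h_span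
    (hN.preimage (continuous_tmul_left y))
  exact h_closure (hv.ge Submodule.mem_top)

end HTensor

section Multiplier

variable {Λ : Type*} {H : Type*} [NormedAddCommGroup H] [InnerProductSpace ℂ H] [CompleteSpace H]
  [RKHS ℂ H Λ ℂ]
  {𝒢' 𝒢 : Type*} [NormedAddCommGroup 𝒢'] [InnerProductSpace ℂ 𝒢'] [CompleteSpace 𝒢']
  [NormedAddCommGroup 𝒢] [InnerProductSpace ℂ 𝒢] [CompleteSpace 𝒢]
  {G : Λ → 𝒢' →L[ℂ] 𝒢}

theorem IsMultiplier.isMultiplierAdjoint_adjoint_mulOp (hG : IsMultiplier H G) :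
    IsMultiplierAdjoint H G ((mulOp H G)†) := by
  obtain ⟨S, hS⟩ := hG
  rwa [mulOp_eq hS, ContinuousLinearMap.adjoint_adjoint]

theorem isContractiveMultiplier_iff :
    IsContractiveMultiplier H G ↔ IsMultiplier H G ∧ ‖mulOp H G‖ ≤ 1 := by
  constructor
  · rintro ⟨S, hS, hS_norm⟩
    exact ⟨⟨S, hS⟩, by rwa [mulOp_eq hS, LinearIsometryEquiv.norm_map]⟩
  · rintro ⟨hG, hG_norm⟩
    exact ⟨_, hG.isMultiplierAdjoint_adjoint_mulOp, by rwa [LinearIsometryEquiv.norm_map]⟩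

theorem IsContractiveMultiplier.isMultiplier (hG : IsContractiveMultiplier H G) :
    IsMultiplier H G :=
  (isContractiveMultiplier_iff.1 hG).1

theorem isMultiplier_and_mulOp_comp_adjoint_eq {X : Type*} [NormedAddCommGroup X]
    [InnerProductSpace ℂ X] [CompleteSpace X] (J : HTensor H 𝒢 →L[ℂ] X)
    (h : ∀ m l η ξ, ⟪kernelVec H m, kernelVec H l⟫_ℂ * ⟪((G m)†) η, ((G l)†) ξ⟫_ℂ =
      ⟪J (HTensor.tmul (kernelVec H m) η), J (HTensor.tmul (kernelVec H l) ξ)⟫_ℂ) :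
    IsMultiplier H G ∧ mulOp H G ∘L (mulOp H G)† = J† ∘L J := by
  obtain ⟨S, hS, hS_inner⟩ := exists_clm_of_inner_eq
    (HTensor.topologicalClosure_span_tmul_of_total (topologicalClosure_span_kernelVec H))
    (fun p : Λ × 𝒢 => HTensor.tmul (kernelVec H p.1) (((G p.1)†) p.2)) J
    fun p q => by rw [HTensor.inner_tmul, h]
  have hGS : IsMultiplierAdjoint H G S := fun l ξ => hS (l, ξ)
  refine ⟨⟨S, hGS⟩, ContinuousLinearMap.ext fun y => ext_inner_left ℂ fun x => ?_⟩
  rw [mulOp_eq hGS, ContinuousLinearMap.adjoint_adjoint]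
  simp only [ContinuousLinearMap.comp_apply, ContinuousLinearMap.adjoint_inner_right, hS_inner]

end Multiplier

section RowOperator

variable {Λ : Type*} {H : Type*} [NormedAddCommGroup H] [InnerProductSpace ℂ H] [CompleteSpace H]
  [RKHS ℂ H Λ ℂ]
  {𝓑 : Type*} [NormedAddCommGroup 𝓑] [InnerProductSpace ℂ 𝓑] [CompleteSpace 𝓑] {β : Λ → 𝓑}

theorem adjoint_rowB_apply (β : Λ → 𝓑) (l : Λ) (c : ℂ) : ((rowB β l)†) c = c • β l := by
  simp [rowB, ContinuousLinearMap.adjoint_innerSL_apply]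

theorem isContractiveMultiplier_rowB {d : Λ → ℂ}
    (h : ∀ m l, ⟪kernelVec H m, kernelVec H l⟫_ℂ * (1 - ⟪β m, β l⟫_ℂ) = d m * star (d l)) :
    IsContractiveMultiplier H (rowB β) := by
  obtain ⟨S, hS, hS_norm⟩ := exists_contraction_of_inner_add_inner_eq
    (HTensor.topologicalClosure_span_tmul_of_total (topologicalClosure_span_kernelVec H))
    (fun p : Λ × ℂ => HTensor.tmul (kernelVec H p.1) (((rowB β p.1)†) p.2))
    (fun p => star (d p.1) * p.2) fun ⟨m, c⟩ ⟨l, c'⟩ => by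
      simp only [HTensor.inner_tmul, adjoint_rowB_apply, inner_smul_left, inner_smul_right,
        RCLike.inner_apply, map_mul, starRingEnd_apply, star_star]
      linear_combination (-(star c * c')) * h m l
  exact ⟨S, fun l ξ => hS (l, ξ), hS_norm⟩

theorem norm_boldB_le (hβ : IsContractiveMultiplier H (rowB β)) : ‖boldB H β‖ ≤ 1 := by
  refine ContinuousLinearMap.opNorm_le_bound _ zero_le_one fun x => ?_
  calc ‖boldB H β x‖ = ‖mulOp H (rowB β) (HTensor.comm 𝓑 H x)‖ :=
        (HTensor.rid H).norm_map _
    _ ≤ 1 * ‖HTensor.comm 𝓑 H x‖ :=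
        (mulOp H (rowB β)).le_of_opNorm_le (isContractiveMultiplier_iff.1 hβ).2 _
    _ = 1 * ‖x‖ := by rw [LinearIsometryEquiv.norm_map]

theorem adjoint_boldB_kernelVec (hβ : IsMultiplier H (rowB β)) (l : Λ) :
    ((boldB H β)†) (kernelVec H l) = HTensor.tmul (β l) (kernelVec H l) := by
  have h_rid : (HTensor.rid H).symm (kernelVec H l) = HTensor.tmul (kernelVec H l) 1 := by
    rw [LinearIsometryEquiv.symm_apply_eq, HTensor.rid_tmul, one_smul]
  have h_comm : (HTensor.comm 𝓑 H).symm (HTensor.tmul (kernelVec H l) (β l)) =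
      HTensor.tmul (β l) (kernelVec H l) := by
    rw [LinearIsometryEquiv.symm_apply_eq, HTensor.comm_tmul]
  have h_row := hβ.isMultiplierAdjoint_adjoint_mulOp l 1
  rw [adjoint_rowB_apply, one_smul] at h_row
  calc ((boldB H β)†) (kernelVec H l)
      = (HTensor.comm 𝓑 H).symm (((mulOp H (rowB β))†) ((HTensor.rid H).symm (kernelVec H l))) := by
        rw [boldB, ContinuousLinearMap.adjoint_comp, ContinuousLinearMap.adjoint_comp,
          LinearIsometryEquiv.adjoint_eq_symm, LinearIsometryEquiv.adjoint_eq_symm]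
        rfl
    _ = HTensor.tmul (β l) (kernelVec H l) := by rw [h_rid, h_row, h_comm]

variable {𝒢 : Type*} [NormedAddCommGroup 𝒢] [InnerProductSpace ℂ 𝒢]

theorem norm_boldBTensorId_le (hβ : IsContractiveMultiplier H (rowB β)) :
    ‖boldBTensorId H 𝒢 β‖ ≤ 1 := by
  refine ContinuousLinearMap.opNorm_le_bound _ zero_le_one fun x => ?_
  have h_map : ‖HTensor.map (boldB H β) (ContinuousLinearMap.id ℂ 𝒢)‖ ≤ 1 :=
    (HTensor.norm_map_le _ _).trans
      (mul_le_one₀ (norm_boldB_le hβ) (norm_nonneg _) ContinuousLinearMap.norm_id_le)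
  calc ‖boldBTensorId H 𝒢 β x‖ ≤ 1 * ‖(HTensor.assoc 𝓑 H 𝒢).symm x‖ :=
        ContinuousLinearMap.le_of_opNorm_le _ h_map _
    _ = 1 * ‖x‖ := by rw [LinearIsometryEquiv.norm_map]

theorem adjoint_boldBTensorId_tmul [CompleteSpace 𝒢] (hβ : IsMultiplier H (rowB β)) (l : Λ)
    (ξ : 𝒢) : ((boldBTensorId H 𝒢 β)†) (HTensor.tmul (kernelVec H l) ξ) =
      HTensor.tmul (β l) (HTensor.tmul (kernelVec H l) ξ) := by
  rw [boldBTensorId, ContinuousLinearMap.adjoint_comp, LinearIsometryEquiv.adjoint_eq_symm,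
    HTensor.adjoint_map, ContinuousLinearMap.adjoint_id, LinearIsometryEquiv.symm_symm,
    ContinuousLinearMap.comp_apply, HTensor.map_tmul, adjoint_boldB_kernelVec hβ]
  exact HTensor.assoc_tmul _ _ _

end RowOperator

section Invariant

variable {E X : Type*} [NormedAddCommGroup E] [InnerProductSpace ℂ E] [CompleteSpace E]
  [NormedAddCommGroup X] [InnerProductSpace ℂ X] [CompleteSpace X]

theorem exists_inner_eq_one_sub_inner_mul_of_invariant (D : HTensor E X →L[ℂ] X) (hD : ‖D‖ ≤ 1)
    {M : Submodule ℂ X} [CompleteSpace M] (hM : ∀ x ∈ HTensor.tensorSubspace E M, D x ∈ M) :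
    ∃ R : X →L[ℂ] X, ∀ b c x y, (D†) x = HTensor.tmul b x → (D†) y = HTensor.tmul c y →
      ⟪R x, R y⟫_ℂ = (1 - ⟪b, c⟫_ℂ) * ⟪M.starProjection x, M.starProjection y⟫_ℂ := by
  set C := D ∘L HTensor.map (ContinuousLinearMap.id ℂ E) M.subtypeL with hC
  have hC_norm : ‖C‖ ≤ 1 := by
    refine (ContinuousLinearMap.opNorm_comp_le _ _).trans (mul_le_one₀ hD (norm_nonneg _) ?_)
    exact (HTensor.norm_map_le _ _).trans
      (mul_le_one₀ ContinuousLinearMap.norm_id_le (norm_nonneg _) M.norm_subtypeL_le)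
  have hC_adjoint : ∀ b x, (D†) x = HTensor.tmul b x →
      (C†) x = HTensor.tmul b (M.orthogonalProjectionOnto x) := fun b x hx => by
    rw [hC, ContinuousLinearMap.adjoint_comp, ContinuousLinearMap.comp_apply, hx,
      HTensor.adjoint_map, HTensor.map_tmul, ContinuousLinearMap.adjoint_id, M.adjoint_subtypeL,
      ContinuousLinearMap.id_apply]
  obtain ⟨R, hR⟩ := exists_inner_eq_inner_starProjection_sub_inner_adjoint C hC_norm M
    fun z => hM _ ⟨z, rfl⟩
  refine ⟨R, fun b c x y hx hy => ?_⟩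
  rw [hR, hC_adjoint b x hx, hC_adjoint c y hy, HTensor.inner_tmul, sub_mul, one_mul]
  rfl

end Invariant

section Symbol

variable {Λ : Type*} {H : Type*} [NormedAddCommGroup H] [InnerProductSpace ℂ H] [CompleteSpace H]
  [RKHS ℂ H Λ ℂ]
  {𝒢' 𝒢 : Type*} [NormedAddCommGroup 𝒢'] [InnerProductSpace ℂ 𝒢'] [CompleteSpace 𝒢']
  [NormedAddCommGroup 𝒢] [InnerProductSpace ℂ 𝒢] [CompleteSpace 𝒢]
  {𝓑 : Type*} [NormedAddCommGroup 𝓑] [InnerProductSpace ℂ 𝓑] {d : Λ → ℂ} {β : Λ → 𝓑}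

/-- The symbol `G` with `conj d(l) • G(l)† ξ = R (k_l ⊗ ξ)`, i.e. `d • G` is the symbol of `R†`.
At a zero of `d` its value is `0`; in the application `k_l = 0` at such a point. -/
noncomputable def beurlingSymbol (d : Λ → ℂ) (R : HTensor H 𝒢 →L[ℂ] 𝒢') (l : Λ) : 𝒢' →L[ℂ] 𝒢 :=
  (d l)⁻¹ • (R ∘L HTensor.tmulL 𝒢 (kernelVec H l))†

theorem adjoint_beurlingSymbol_apply (d : Λ → ℂ) (R : HTensor H 𝒢 →L[ℂ] 𝒢') (l : Λ) (ξ : 𝒢) :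
    ((beurlingSymbol d R l)†) ξ = (star (d l))⁻¹ • R (HTensor.tmul (kernelVec H l) ξ) := by
  simp [beurlingSymbol, map_smulₛₗ]

theorem inner_kernelVec_mul_inner_adjoint_beurlingSymbol {X : Type*} [NormedAddCommGroup X]
    [InnerProductSpace ℂ X] {R : HTensor H 𝒢 →L[ℂ] 𝒢'} {J : HTensor H 𝒢 →L[ℂ] X}
    (hβ : ∀ l, ‖β l‖ < 1)
    (hk : ∀ m l, ⟪kernelVec H m, kernelVec H l⟫_ℂ = d m * star (d l) / (1 - ⟪β m, β l⟫_ℂ))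
    (hR : ∀ m l η ξ,
      ⟪R (HTensor.tmul (kernelVec H m) η), R (HTensor.tmul (kernelVec H l) ξ)⟫_ℂ =
        (1 - ⟪β m, β l⟫_ℂ) *
          ⟪J (HTensor.tmul (kernelVec H m) η), J (HTensor.tmul (kernelVec H l) ξ)⟫_ℂ)
    (m l : Λ) (η ξ : 𝒢) :
    ⟪kernelVec H m, kernelVec H l⟫_ℂ *
        ⟪((beurlingSymbol d R m)†) η, ((beurlingSymbol d R l)†) ξ⟫_ℂ =
      ⟪J (HTensor.tmul (kernelVec H m) η), J (HTensor.tmul (kernelVec H l) ξ)⟫_ℂ := by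
  have kernelVec_eq_zero : ∀ l, d l = 0 → kernelVec H l = 0 := fun l hl => by
    rw [← inner_self_eq_zero (𝕜 := ℂ), hk, hl, zero_mul, zero_div]
  by_cases hm : d m = 0
  · simp [kernelVec_eq_zero m hm, HTensor.zero_tmul]
  by_cases hl : d l = 0
  · simp [kernelVec_eq_zero l hl, HTensor.zero_tmul]
  have hl' : star (d l) ≠ 0 := star_ne_zero.2 hl
  have h_denom : 1 - ⟪β m, β l⟫_ℂ ≠ 0 := one_sub_inner_ne_zero (hβ m) (hβ l)
  rw [adjoint_beurlingSymbol_apply, adjoint_beurlingSymbol_apply, inner_smul_left,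
    inner_smul_right, hR, hk, map_inv₀, starRingEnd_apply, star_star]
  field_simp

end Symbol

theorem mainTheorem5_general {Λ : Type*} {K : Λ → Λ → ℂ}
    {H : Type u} [NormedAddCommGroup H] [InnerProductSpace ℂ H] [CompleteSpace H]
    [RKHS ℂ H Λ ℂ] (hH : HasKernel H K) {d : Λ → ℂ}
    {𝓑 : Type*} [NormedAddCommGroup 𝓑] [InnerProductSpace ℂ 𝓑] [CompleteSpace 𝓑]
    {β : Λ → 𝓑} (hβ : ∀ l, ‖β l‖ < 1)
    (hK : ∀ m l, K m l = d m * star (d l) / (1 - inner ℂ (β m) (β l)))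
    {𝒢 : Type v} [NormedAddCommGroup 𝒢] [InnerProductSpace ℂ 𝒢] [CompleteSpace 𝒢]
    (M : ClosedSubmodule ℂ (HTensor H 𝒢))
    (hM : ∀ x ∈ HTensor.tensorSubspace 𝓑 M.toSubmodule, boldBTensorId H 𝒢 β x ∈ M) :
    ∃ (𝒢' : Type (max u v)) (_ : NormedAddCommGroup 𝒢') (_ : InnerProductSpace ℂ 𝒢')
      (_ : CompleteSpace 𝒢') (G : Λ → 𝒢' →L[ℂ] 𝒢),
      IsContractiveMultiplier H G ∧
      mulOp H G ∘L (mulOp H G).adjoint = M.toSubmodule.starProjection ∧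
      LinearMap.range (mulOp H G).toLinearMap = M.toSubmodule ∧
      ∀ x ∈ M, rangeNorm (mulOp H G) x = ‖x‖ := by
  have hk : ∀ m l, ⟪kernelVec H m, kernelVec H l⟫_ℂ = d m * star (d l) / (1 - ⟪β m, β l⟫_ℂ) :=
    fun m l => by rw [hH.inner_kernelVec, hK]
  have h_row : IsContractiveMultiplier H (rowB β) := isContractiveMultiplier_rowB fun m l => by
    rw [hk, div_mul_cancel₀ _ (one_sub_inner_ne_zero (hβ m) (hβ l))]
  have : CompleteSpace M.toSubmodule := M.isClosed'.completeSpace_coe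
  obtain ⟨R, hR⟩ := exists_inner_eq_one_sub_inner_mul_of_invariant _
    (norm_boldBTensorId_le h_row) hM
  have hR_kernel := fun m l η ξ => hR _ _ _ _
    (adjoint_boldBTensorId_tmul h_row.isMultiplier m η)
    (adjoint_boldBTensorId_tmul h_row.isMultiplier l ξ)
  obtain ⟨hG, hGG⟩ := isMultiplier_and_mulOp_comp_adjoint_eq M.toSubmodule.starProjection
    (inner_kernelVec_mul_inner_adjoint_beurlingSymbol hβ hk hR_kernel)
  have h_proj : mulOp H (beurlingSymbol d R) ∘L (mulOp H (beurlingSymbol d R))† =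
      M.toSubmodule.starProjection := by
    rw [hGG, (isSelfAdjoint_starProjection _).adjoint_eq]
    exact M.toSubmodule.isIdempotentElem_starProjection
  exact ⟨HTensor H 𝒢, inferInstance, inferInstance, inferInstance, beurlingSymbol d R,
    isContractiveMultiplier_iff.2 ⟨hG, norm_le_one_of_self_comp_adjoint_eq_starProjection h_proj⟩,
    h_proj, range_eq_of_self_comp_adjoint_eq_starProjection h_proj,
    fun _ => rangeNorm_eq_norm_of_self_comp_adjoint_eq_starProjection h_proj⟩

theorem mainTheorem5 {Λ : Type*}
    (K : Λ → Λ → ℂ) (hK : IsPickKernel K)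
    (H : Type u) [NormedAddCommGroup H] [InnerProductSpace ℂ H] [CompleteSpace H]
    [RKHS ℂ H Λ ℂ] (hH : HasKernel H K)
    (l₀ : Λ)
    (𝓑 : Type*) [NormedAddCommGroup 𝓑] [InnerProductSpace ℂ 𝓑] [CompleteSpace 𝓑]
    (β : Λ → 𝓑) (hβ : IsPickRepresentation H K l₀ β)
    (𝒢 : Type v) [NormedAddCommGroup 𝒢] [InnerProductSpace ℂ 𝒢] [CompleteSpace 𝒢]
    (M : ClosedSubmodule ℂ (HTensor H 𝒢))
    (hM : ∀ x ∈ HTensor.tensorSubspace 𝓑 M.toSubmodule, boldBTensorId H 𝒢 β x ∈ M) :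
    ∃ (𝒢' : Type (max u v)) (_ : NormedAddCommGroup 𝒢') (_ : InnerProductSpace ℂ 𝒢')
      (_ : CompleteSpace 𝒢') (G : Λ → 𝒢' →L[ℂ] 𝒢),
      IsContractiveMultiplier H G ∧
      mulOp H G ∘L (mulOp H G).adjoint = M.toSubmodule.starProjection ∧
      LinearMap.range (mulOp H G).toLinearMap = M.toSubmodule ∧
      ∀ x ∈ M, rangeNorm (mulOp H G) x = ‖x‖ :=
  mainTheorem5_general hH hβ.norm_lt_one hβ.eq_kernel M hM
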